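/- A (bivariate) copula is a function $C\colon[0,1]^2\to[0,1]$ with $C(s,0)=C(0,s)=0$, $C(s,1)=C(1,s)=s$ for all $s\in[0,1]$ and $C(u_2,v_2)-C(u_2,v_1)-C(u_1,v_2)+C(u_1,v_1)\ge 0$ whenever $0\le u_1\le u_2\le 1$ and $0\le v_1\le v_2\le 1$. Gini's gamma of $C$ is $$\gamma(C)=4\int_0^1\bigl[C(u,u)+C(u,1-u)\bigr]\,du-2 .$$ For $t\in[-1,1]$ let ${\bf G}_t$ be the set of copulas $C$ with $\gamma(C)=t$, and for $(u,v)\in[0,1]^2$ let $$\overline G_t(u,v)=\sup\{C(u,v):C\in{\bf G}_t\},\qquad \underline G_t(u,v)=\inf\{C(u,v):C\in{\bf G}_t\}.$$ Write $x\vee y=\max(x,y)$ and $x\wedge y=\min(x,y)$, and, for $(u,v)\in[0,1]^2$, put $M=u\vee v$, $m=u\wedge v$ and \begin{align*} \theta_1&=\tfrac12\Bigl(u+v-1+\sqrt{(u+v-1)^2+t+1}\Bigr),\\ \theta_2&=\tfrac14\Bigl(3M+m-2+\sqrt{(u+v)^2+4(1-u)(1-v)+2t}\Bigr),\\ \theta_3&=\tfrac17\Bigl(4M+2m-3+\sqrt{16M^2+4m^2-24M-12m+16uv+7t+16}\Bigr),\\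 \theta_4&=\tfrac17\Bigl(5M+3m-4+\sqrt{4M^2+16m^2-12M-24m+16uv+7t+16}\Bigr),\\ \theta_5&=\tfrac16\Bigl(3(u+v-1)+\sqrt{3(5u^2+5v^2-6u-6v+2uv+2t+5)}\Bigr). \end{align*} (Only the radicand of $\theta_2$ can be negative; the square root is then read as $0$, and such points do not lie in $R_2$ below.) Let $R_1,\dots,R_5\subseteq[0,1]^2$ be the sets of points $(u,v)$ that satisfy, respectively, \begin{align*} R_1&:\ \tfrac12+\theta_1\le M,\\ R_2&:\ (m+\theta_2)\vee\tfrac{1+\theta_2}{2}\le M\le\tfrac12+\theta_2,\\ R_3&:\ m+\theta_3\le M\le\tfrac{1+\theta_3}{2},\\ R_4&:\ \tfrac{1+\theta_4}{2}\le M\le m+\theta_4,\\ R_5&:\ M\le(m+\theta_5)\wedge\tfrac{1+\theta_5}{2}, \end{align*} and let $\chi_{\theta_i}$ be the characteristic function of $R_i$. Theorem. For every $t\in[-1,1]$ and every $(u,v)\in[0,1]^2$, the set $\{C(u,v):C\in{\bf G}_t\}$ is non-empty and bounded (so that the supremum and the infimum are genuine), $$\overline G_t(u,v)=\min\bigl(u,\,v,\,\max(\chi_{\theta_1}\theta_1,\chi_{\theta_2}\theta_2,\chi_{\theta_3}\theta_3,\chi_{\theta_4}\theta_4,\chi_{\theta_5}\theta_5)\bigr),$$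 and $$\underline G_t(u,v)=v-\overline G_{-t}(1-u,v).$$ -/

import Mathlib

open Set

noncomputable section

/-- A bivariate copula `C : [0,1]² → [0,1]`. It is represented by a function on `ℝ × ℝ` of which
only the values on the unit square are constrained (and used). -/
structure IsCopula (C : ℝ → ℝ → ℝ) : Prop where
  mem_Icc : ∀ u ∈ Icc (0 : ℝ) 1, ∀ v ∈ Icc (0 : ℝ) 1, C u v ∈ Icc (0 : ℝ) 1
  right_zero : ∀ s ∈ Icc (0 : ℝ) 1, C s 0 = 0
  left_zero : ∀ s ∈ Icc (0 : ℝ) 1, C 0 s = 0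
  right_one : ∀ s ∈ Icc (0 : ℝ) 1, C s 1 = s
  left_one : ∀ s ∈ Icc (0 : ℝ) 1, C 1 s = s
  two_increasing : ∀ u₁ ∈ Icc (0 : ℝ) 1, ∀ u₂ ∈ Icc (0 : ℝ) 1, ∀ v₁ ∈ Icc (0 : ℝ) 1,
    ∀ v₂ ∈ Icc (0 : ℝ) 1, u₁ ≤ u₂ → v₁ ≤ v₂ →
      0 ≤ C u₂ v₂ - C u₂ v₁ - C u₁ v₂ + C u₁ v₁

/-- Gini's gamma of a copula. -/
def giniGamma (C : ℝ → ℝ → ℝ) : ℝ :=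
  4 * (∫ u in (0 : ℝ)..1, (C u u + C u (1 - u))) - 2

/-- The set `G_t` of copulas whose Gini's gamma equals `t`. -/
def giniSet (t : ℝ) : Set (ℝ → ℝ → ℝ) :=
  {C | IsCopula C ∧ giniGamma C = t}

/-- The set of values at `(u, v)` of the copulas in `G_t`. -/
def giniValues (t u v : ℝ) : Set ℝ :=
  {x | ∃ C ∈ giniSet t, C u v = x}

/-- The pointwise supremum of `G_t`. -/
def giniUpper (t u v : ℝ) : ℝ := sSup (giniValues t u v)

/-- The pointwise infimum of `G_t`. -/
def giniLower (t u v : ℝ) : ℝ := sInf (giniValues t u v)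

def giniTheta1 (t u v : ℝ) : ℝ :=
  (u + v - 1 + √((u + v - 1) ^ 2 + t + 1)) / 2

def giniTheta2 (t u v : ℝ) : ℝ :=
  (3 * max u v + min u v - 2 + √((u + v) ^ 2 + 4 * (1 - u) * (1 - v) + 2 * t)) / 4

def giniTheta3 (t u v : ℝ) : ℝ :=
  (4 * max u v + 2 * min u v - 3
    + √(16 * (max u v) ^ 2 + 4 * (min u v) ^ 2 - 24 * max u v - 12 * min u v
        + 16 * u * v + 7 * t + 16)) / 7

def giniTheta4 (t u v : ℝ) : ℝ :=
  (5 * max u v + 3 * min u v - 4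
    + √(4 * (max u v) ^ 2 + 16 * (min u v) ^ 2 - 12 * max u v - 24 * min u v
        + 16 * u * v + 7 * t + 16)) / 7

def giniTheta5 (t u v : ℝ) : ℝ :=
  (3 * (u + v - 1)
    + √(3 * (5 * u ^ 2 + 5 * v ^ 2 - 6 * u - 6 * v + 2 * u * v + 2 * t + 5))) / 6

/-! The five subsets of the unit square: the `i`-th one is given by the inequalities of the `i`-th
case of the piecewise formula for Gini's gamma of the smallest copula with value `θ` at `(u, v)`,
taken at `θ = θ_i`. -/

def giniRegion1 (t : ℝ) : Set (ℝ × ℝ) :=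
  {p | p ∈ Icc (0 : ℝ) 1 ×ˢ Icc (0 : ℝ) 1 ∧
    1 / 2 + giniTheta1 t p.1 p.2 ≤ max p.1 p.2}

def giniRegion2 (t : ℝ) : Set (ℝ × ℝ) :=
  {p | p ∈ Icc (0 : ℝ) 1 ×ˢ Icc (0 : ℝ) 1 ∧
    max (min p.1 p.2 + giniTheta2 t p.1 p.2) ((1 + giniTheta2 t p.1 p.2) / 2) ≤ max p.1 p.2 ∧
    max p.1 p.2 ≤ 1 / 2 + giniTheta2 t p.1 p.2}

def giniRegion3 (t : ℝ) : Set (ℝ × ℝ) :=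
  {p | p ∈ Icc (0 : ℝ) 1 ×ˢ Icc (0 : ℝ) 1 ∧
    min p.1 p.2 + giniTheta3 t p.1 p.2 ≤ max p.1 p.2 ∧
    max p.1 p.2 ≤ (1 + giniTheta3 t p.1 p.2) / 2}

def giniRegion4 (t : ℝ) : Set (ℝ × ℝ) :=
  {p | p ∈ Icc (0 : ℝ) 1 ×ˢ Icc (0 : ℝ) 1 ∧
    (1 + giniTheta4 t p.1 p.2) / 2 ≤ max p.1 p.2 ∧
    max p.1 p.2 ≤ min p.1 p.2 + giniTheta4 t p.1 p.2}

def giniRegion5 (t : ℝ) : Set (ℝ × ℝ) :=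
  {p | p ∈ Icc (0 : ℝ) 1 ×ˢ Icc (0 : ℝ) 1 ∧
    max p.1 p.2 ≤ min (min p.1 p.2 + giniTheta5 t p.1 p.2) ((1 + giniTheta5 t p.1 p.2) / 2)}

/-- The characteristic function of a subset of the plane. -/
def charFn (S : Set (ℝ × ℝ)) (u v : ℝ) : ℝ := S.indicator (fun _ => (1 : ℝ)) (u, v)

end

/-! A copula is increasing and 1-Lipschitz in each variable and lies above `max 0 (x + y - 1)`.
Hence among the copulas with value θ at (a, b) there is a pointwise smallest one, `minCopulaAt θ a
b`, and as γ is monotone it also has the least γ in that class. By transposition b ≤ a may be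
assumed; then this least value is the explicit function `minGini a b θ`, which is strictly
increasing above the Fréchet bound and equals -1 there. So a copula with γ = t has value at most y
at (a, b), where y solves `minGini a b y = t`, and at most b.

The bound is attained: if y ≤ b by `minCopulaAt y a b`; if y > b by a mixture of `minCopulaAt b a b`
and `min`, both with value b at (a, b) and with γ on either side of t.

In θ, `minGini` is piecewise quadratic with five pieces, θ_i is the larger root of the i-th
equation, and R_i says that θ_i lies in its own piece. `giniBranchMax_eq` deduces that the maximum
of the branches is y. The infimum follows because reflection in the first variable negates γ. -/

namespace IsCopula

/-! ### Copulas: regularity, symmetries, mixtures and Gini's gamma -/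

variable {C D : ℝ → ℝ → ℝ}

theorem mono_left (hC : IsCopula C) {x₁ x₂ y : ℝ} (h₁ : 0 ≤ x₁) (h : x₁ ≤ x₂) (h₂ : x₂ ≤ 1)
    (hy : y ∈ Icc (0 : ℝ) 1) : C x₁ y ≤ C x₂ y := by
  have hx₁ : x₁ ∈ Icc (0 : ℝ) 1 := ⟨h₁, h.trans h₂⟩
  have hx₂ : x₂ ∈ Icc (0 : ℝ) 1 := ⟨h₁.trans h, h₂⟩
  have := hC.two_increasing x₁ hx₁ x₂ hx₂ 0 ⟨le_rfl, zero_le_one⟩ y hy h hy.1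
  rw [hC.right_zero x₁ hx₁, hC.right_zero x₂ hx₂] at this
  linarith

theorem sub_le_left (hC : IsCopula C) {x₁ x₂ y : ℝ} (h₁ : 0 ≤ x₁) (h : x₁ ≤ x₂) (h₂ : x₂ ≤ 1)
    (hy : y ∈ Icc (0 : ℝ) 1) : C x₂ y - C x₁ y ≤ x₂ - x₁ := by
  have hx₁ : x₁ ∈ Icc (0 : ℝ) 1 := ⟨h₁, h.trans h₂⟩
  have hx₂ : x₂ ∈ Icc (0 : ℝ) 1 := ⟨h₁.trans h, h₂⟩
  have := hC.two_increasing x₁ hx₁ x₂ hx₂ y hy 1 ⟨zero_le_one, le_rfl⟩ h hy.2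
  rw [hC.right_one x₁ hx₁, hC.right_one x₂ hx₂] at this
  linarith

/-- The transpose of a copula is a copula. -/
theorem transpose (hC : IsCopula C) : IsCopula (fun x y => C y x) where
  mem_Icc x hx y hy := hC.mem_Icc y hy x hx
  right_zero := hC.left_zero
  left_zero := hC.right_zero
  right_one := hC.left_one
  left_one := hC.right_one
  two_increasing x₁ hx₁ x₂ hx₂ y₁ hy₁ y₂ hy₂ hx hy := by
    have := hC.two_increasing y₁ hy₁ y₂ hy₂ x₁ hx₁ x₂ hx₂ hy hx
    linarith

/-- The reflection of a copula in its first variable is a copula. -/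
theorem reflect (hC : IsCopula C) : IsCopula (fun x y => y - C (1 - x) y) where
  mem_Icc x hx y hy := by
    have hx' : 1 - x ∈ Icc (0 : ℝ) 1 := ⟨by linarith [hx.2], by linarith [hx.1]⟩
    have h₀ := hC.mem_Icc _ hx' y hy
    have h₁ := hC.mono_left hx'.1 hx'.2 le_rfl hy
    rw [hC.left_one y hy] at h₁
    exact ⟨by linarith, by linarith [h₀.1, hy.2]⟩
  right_zero x hx := by
    rw [hC.right_zero (1 - x) ⟨by linarith [hx.2], by linarith [hx.1]⟩, sub_zero]
  left_zero y hy := by simp [hC.left_one y hy]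
  right_one x hx := by
    rw [hC.right_one (1 - x) ⟨by linarith [hx.2], by linarith [hx.1]⟩]; ring
  left_one y hy := by simp [hC.left_zero y hy]
  two_increasing x₁ hx₁ x₂ hx₂ y₁ hy₁ y₂ hy₂ hx hy := by
    have := hC.two_increasing (1 - x₂) ⟨by linarith [hx₂.2], by linarith [hx₂.1]⟩
      (1 - x₁) ⟨by linarith [hx₁.2], by linarith [hx₁.1]⟩ y₁ hy₁ y₂ hy₂ (by linarith) hy
    linarith

theorem convexCombination (hC : IsCopula C) (hD : IsCopula D) {r : ℝ} (h₀ : 0 ≤ r) (h₁ : r ≤ 1) :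
    IsCopula (fun x y => r * C x y + (1 - r) * D x y) where
  mem_Icc x hx y hy := by
    have h := hC.mem_Icc x hx y hy
    have h' := hD.mem_Icc x hx y hy
    have hr : 0 ≤ 1 - r := by linarith
    exact ⟨add_nonneg (mul_nonneg h₀ h.1) (mul_nonneg hr h'.1),
      by linarith [mul_le_mul_of_nonneg_left h.2 h₀, mul_le_mul_of_nonneg_left h'.2 hr]⟩
  right_zero x hx := by rw [hC.right_zero x hx, hD.right_zero x hx]; ring
  left_zero x hx := by rw [hC.left_zero x hx, hD.left_zero x hx]; ring
  right_one x hx := by rw [hC.right_one x hx, hD.right_one x hx]; ring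
  left_one x hx := by rw [hC.left_one x hx, hD.left_one x hx]; ring
  two_increasing x₁ hx₁ x₂ hx₂ y₁ hy₁ y₂ hy₂ hx hy := by
    have h := mul_nonneg h₀ (hC.two_increasing x₁ hx₁ x₂ hx₂ y₁ hy₁ y₂ hy₂ hx hy)
    have h' := mul_nonneg (sub_nonneg.2 h₁)
      (hD.two_increasing x₁ hx₁ x₂ hx₂ y₁ hy₁ y₂ hy₂ hx hy)
    linarith

theorem abs_sub_le_left (hC : IsCopula C) {x₁ x₂ y : ℝ} (h₁ : x₁ ∈ Icc (0 : ℝ) 1)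
    (h₂ : x₂ ∈ Icc (0 : ℝ) 1) (hy : y ∈ Icc (0 : ℝ) 1) : |C x₁ y - C x₂ y| ≤ |x₁ - x₂| := by
  wlog h : x₂ ≤ x₁ generalizing x₁ x₂
  · rw [abs_sub_comm, abs_sub_comm x₁]
    exact this h₂ h₁ (le_of_not_ge h)
  · rw [abs_of_nonneg (sub_nonneg.2 (hC.mono_left h₂.1 h h₁.2 hy)), abs_of_nonneg (sub_nonneg.2 h)]
    exact hC.sub_le_left h₂.1 h h₁.2 hy

theorem abs_sub_le (hC : IsCopula C) {x₁ x₂ y₁ y₂ : ℝ} (hx₁ : x₁ ∈ Icc (0 : ℝ) 1)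
    (hx₂ : x₂ ∈ Icc (0 : ℝ) 1) (hy₁ : y₁ ∈ Icc (0 : ℝ) 1) (hy₂ : y₂ ∈ Icc (0 : ℝ) 1) :
    |C x₁ y₁ - C x₂ y₂| ≤ |x₁ - x₂| + |y₁ - y₂| :=
  (_root_.abs_sub_le _ (C x₂ y₁) _).trans
    (add_le_add (hC.abs_sub_le_left hx₁ hx₂ hy₁) (hC.transpose.abs_sub_le_left hy₁ hy₂ hx₂))

theorem continuousOn_diag (hC : IsCopula C) : ContinuousOn (fun u => C u u) (Icc 0 1) := by
  refine LipschitzOnWith.continuousOn (K := 2) (LipschitzOnWith.of_dist_le_mul ?_)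
  intro x hx y hy
  have := hC.abs_sub_le hx hy hx hy
  simp only [Real.dist_eq, NNReal.coe_ofNat]
  linarith

theorem continuousOn_antidiag (hC : IsCopula C) :
    ContinuousOn (fun u => C u (1 - u)) (Icc 0 1) := by
  -- The diagonal of the reflected transpose is u - C(u, 1 - u).
  refine (continuousOn_id.sub (hC.transpose.reflect.continuousOn_diag)).congr fun u _ => ?_
  simp

theorem intervalIntegrable_diag (hC : IsCopula C) :
    IntervalIntegrable (fun u => C u u) MeasureTheory.volume 0 1 :=
  ContinuousOn.intervalIntegrable (by simpa using hC.continuousOn_diag)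

theorem intervalIntegrable_antidiag (hC : IsCopula C) :
    IntervalIntegrable (fun u => C u (1 - u)) MeasureTheory.volume 0 1 :=
  ContinuousOn.intervalIntegrable (by simpa using hC.continuousOn_antidiag)

theorem giniGamma_eq (hC : IsCopula C) :
    giniGamma C = 4 * ((∫ u in (0 : ℝ)..1, C u u) + ∫ u in (0 : ℝ)..1, C u (1 - u)) - 2 := by
  rw [giniGamma, intervalIntegral.integral_add hC.intervalIntegrable_diag
    hC.intervalIntegrable_antidiag]

theorem giniGamma_transpose (hC : IsCopula C) :
    giniGamma (fun x y => C y x) = giniGamma C := by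
  rw [hC.transpose.giniGamma_eq, hC.giniGamma_eq]
  have := intervalIntegral.integral_comp_sub_left (a := 0) (b := 1) (fun u => C u (1 - u)) 1
  simp only [sub_sub_cancel, sub_self, sub_zero] at this
  rw [this]

/-- Up to u ↦ 1 - u, reflection interchanges the diagonal and antidiagonal integrals and changes
their signs; the added terms u and 1 - u integrate to 1 in total, which the normalisation 4 · - 2
turns into an exact sign change. -/
theorem giniGamma_reflect (hC : IsCopula C) :
    giniGamma (fun x y => y - C (1 - x) y) = - giniGamma C := by
  have hA := intervalIntegral.integral_comp_sub_left (a := 0) (b := 1) (fun u => C u (1 - u)) 1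
  have hD := intervalIntegral.integral_comp_sub_left (a := 0) (b := 1) (fun u => C u u) 1
  have hiA := hC.intervalIntegrable_antidiag.comp_sub_left 1
  have hiD := hC.intervalIntegrable_diag.comp_sub_left 1
  simp only [sub_sub_cancel, sub_self, sub_zero] at hA hD hiA hiD
  rw [hC.reflect.giniGamma_eq, hC.giniGamma_eq, intervalIntegral.integral_sub intervalIntegral.intervalIntegrable_id hiA.symm,
    intervalIntegral.integral_sub (intervalIntegrable_const.sub intervalIntegral.intervalIntegrable_id) hiD.symm, hA, hD,
    intervalIntegral.integral_sub intervalIntegrable_const intervalIntegral.intervalIntegrable_id]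
  simp only [integral_id, intervalIntegral.integral_const, smul_eq_mul]
  ring

theorem giniGamma_convexCombination (hC : IsCopula C) (hD : IsCopula D) {r : ℝ} (h₀ : 0 ≤ r)
    (h₁ : r ≤ 1) : giniGamma (fun x y => r * C x y + (1 - r) * D x y) =
      r * giniGamma C + (1 - r) * giniGamma D := by
  rw [(hC.convexCombination hD h₀ h₁).giniGamma_eq, hC.giniGamma_eq, hD.giniGamma_eq,
    intervalIntegral.integral_add (hC.intervalIntegrable_diag.const_mul _)
      (hD.intervalIntegrable_diag.const_mul _),
    intervalIntegral.integral_add (hC.intervalIntegrable_antidiag.const_mul _)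
      (hD.intervalIntegrable_antidiag.const_mul _)]
  simp only [intervalIntegral.integral_const_mul]
  ring

theorem giniGamma_mono (hC : IsCopula C) (hD : IsCopula D)
    (h : ∀ x ∈ Icc (0 : ℝ) 1, ∀ y ∈ Icc (0 : ℝ) 1, C x y ≤ D x y) :
    giniGamma C ≤ giniGamma D := by
  rw [hC.giniGamma_eq, hD.giniGamma_eq]
  have hd := intervalIntegral.integral_mono_on zero_le_one hC.intervalIntegrable_diag
    hD.intervalIntegrable_diag fun u hu => h u hu u hu
  have ha := intervalIntegral.integral_mono_on zero_le_one hC.intervalIntegrable_antidiag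
    hD.intervalIntegrable_antidiag fun u hu =>
      h u hu (1 - u) ⟨by linarith [hu.2], by linarith [hu.1]⟩
  linarith

theorem le_min (hC : IsCopula C) {x y : ℝ} (hx : x ∈ Icc (0 : ℝ) 1) (hy : y ∈ Icc (0 : ℝ) 1) :
    C x y ≤ min x y := by
  have h₁ := hC.mono_left hx.1 hx.2 le_rfl hy
  have h₂ := hC.transpose.mono_left hy.1 hy.2 le_rfl hx
  rw [hC.left_one y hy] at h₁
  simp only [hC.right_one x hx] at h₂
  exact _root_.le_min h₂ h₁

theorem max_le (hC : IsCopula C) {x y : ℝ} (hx : x ∈ Icc (0 : ℝ) 1) (hy : y ∈ Icc (0 : ℝ) 1) :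
    max 0 (x + y - 1) ≤ C x y := by
  have := hC.sub_le_left hx.1 hx.2 le_rfl hy
  rw [hC.left_one y hy] at this
  exact _root_.max_le (hC.mem_Icc x hx y hy).1 (by linarith)

/-- Monotonicity (x ≥ a) and the Lipschitz bound (x ≤ a) in one inequality; used once per variable,
it bounds C below by its value at a single point. -/
theorem sub_posPart_le_left (hC : IsCopula C) {a x y : ℝ} (ha : a ∈ Icc (0 : ℝ) 1)
    (hx : x ∈ Icc (0 : ℝ) 1) (hy : y ∈ Icc (0 : ℝ) 1) : C a y - max (a - x) 0 ≤ C x y := by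
  rcases le_total a x with h | h
  · linarith [hC.mono_left ha.1 h hx.2 hy, le_max_right (a - x) 0]
  · linarith [hC.sub_le_left hx.1 h ha.2 hy, le_max_left (a - x) 0]

end IsCopula

/-! ### The smallest copula through a given value -/

/-- The smallest copula with the value `θ` at `(a, b)`. -/
noncomputable def minCopulaAt (θ a b x y : ℝ) : ℝ :=
  max (max 0 (x + y - 1)) (θ - max (a - x) 0 - max (b - y) 0)

theorem IsCopula.minCopulaAt_le {C : ℝ → ℝ → ℝ} (hC : IsCopula C) {a b x y : ℝ}
    (ha : a ∈ Icc (0 : ℝ) 1) (hb : b ∈ Icc (0 : ℝ) 1) (hx : x ∈ Icc (0 : ℝ) 1)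
    (hy : y ∈ Icc (0 : ℝ) 1) : minCopulaAt (C a b) a b x y ≤ C x y := by
  have h₁ := hC.sub_posPart_le_left ha hx hy
  have h₂ := hC.transpose.sub_posPart_le_left hb hy ha
  exact _root_.max_le (hC.max_le hx hy) (by linarith)

theorem minCopulaAt_self {θ a b : ℝ} (h : max 0 (a + b - 1) ≤ θ) : minCopulaAt θ a b a b = θ := by
  simpa [minCopulaAt] using h

/-- Each of the three functions under the maximum is a function of x plus a function of y, with
slopes 0, between 0 and 1, and 1 respectively. If the two mixed corners use two of them, taking the
steeper at (x₂, y₂) and the flatter at (x₁, y₁) gives a sum at least as large. -/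
theorem minCopulaAt_two_increasing (θ a b : ℝ) {x₁ x₂ y₁ y₂ : ℝ}
    (hx : x₁ ≤ x₂) (hy : y₁ ≤ y₂) :
    minCopulaAt θ a b x₂ y₁ + minCopulaAt θ a b x₁ y₂ ≤
      minCopulaAt θ a b x₂ y₂ + minCopulaAt θ a b x₁ y₁ := by
  have lower : ∀ x y, 0 ≤ minCopulaAt θ a b x y ∧ x + y - 1 ≤ minCopulaAt θ a b x y ∧
      θ - max (a - x) 0 - max (b - y) 0 ≤ minCopulaAt θ a b x y := fun x y =>
    ⟨(le_max_left _ _).trans (le_max_left _ _), (le_max_right _ _).trans (le_max_left _ _),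
      le_max_right _ _⟩
  have attained : ∀ x y, minCopulaAt θ a b x y = 0 ∨ minCopulaAt θ a b x y = x + y - 1 ∨
      minCopulaAt θ a b x y = θ - max (a - x) 0 - max (b - y) 0 := fun x y => by
    unfold minCopulaAt
    rcases max_choice (max 0 (x + y - 1)) (θ - max (a - x) 0 - max (b - y) 0) with h | h
    · rw [h]
      rcases max_choice 0 (x + y - 1) with h | h <;> simp [h]
    · exact Or.inr (Or.inr h)
  obtain ⟨l₁, l₂, l₃⟩ := lower x₂ y₂
  obtain ⟨m₁, m₂, m₃⟩ := lower x₁ y₁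
  generalize minCopulaAt θ a b x₂ y₂ = p at *
  generalize minCopulaAt θ a b x₁ y₁ = q at *
  have hx₁ := max_cases (a - x₁) 0
  have hx₂ := max_cases (a - x₂) 0
  have hy₁ := max_cases (b - y₁) 0
  have hy₂ := max_cases (b - y₂) 0
  rcases attained x₂ y₁ with h | h | h <;> rcases attained x₁ y₂ with h' | h' | h' <;>
    rw [h, h'] <;> try linarith
  all_goals
    rcases hx₁ with hx₁ | hx₁ <;> rcases hx₂ with hx₂ | hx₂ <;> rcases hy₁ with hy₁ | hy₁ <;>
      rcases hy₂ with hy₂ | hy₂ <;> linarith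

/-- Since θ ≤ a and θ ≤ b, the term added to the Fréchet lower bound stays below `min x y`, so the
margins survive. -/
theorem isCopula_minCopulaAt {θ a b : ℝ} (ha : a ≤ 1) (hθa : θ ≤ a) (hθb : θ ≤ b) : IsCopula (minCopulaAt θ a b) where
  mem_Icc x hx y hy := by
    refine ⟨(le_max_left _ _).trans (le_max_left _ _), max_le (max_le zero_le_one ?_) ?_⟩
    · linarith [hx.2, hy.2]
    · linarith [le_max_right (a - x) 0, le_max_right (b - y) 0]
  right_zero x hx := by
    refine le_antisymm (max_le (max_le le_rfl ?_) ?_) ((le_max_left _ _).trans (le_max_left _ _))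
    · linarith [hx.2]
    · linarith [le_max_right (a - x) 0, le_max_left (b - 0) 0]
  left_zero y hy := by
    refine le_antisymm (max_le (max_le le_rfl ?_) ?_) ((le_max_left _ _).trans (le_max_left _ _))
    · linarith [hy.2]
    · linarith [le_max_left (a - 0) 0, le_max_right (b - y) 0]
  right_one x hx := by
    refine le_antisymm (max_le (max_le hx.1 ?_) ?_)
      (le_trans ?_ ((le_max_right _ _).trans (le_max_left _ _)))
    · linarith
    · linarith [le_max_left (a - x) 0, le_max_right (b - 1) 0]
    · linarith
  left_one y hy := by
    refine le_antisymm (max_le (max_le hy.1 ?_) ?_)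
      (le_trans ?_ ((le_max_right _ _).trans (le_max_left _ _)))
    · linarith
    · linarith [le_max_right (a - 1) 0, le_max_left (b - y) 0]
    · linarith
  two_increasing x₁ _ x₂ _ y₁ _ y₂ _ hx hy := by
    linarith [minCopulaAt_two_increasing θ a b hx hy]

theorem isCopula_min : IsCopula (fun x y => min x y) where
  mem_Icc x hx y hy := ⟨le_min hx.1 hy.1, (min_le_left _ _).trans hx.2⟩
  right_zero x hx := min_eq_right hx.1
  left_zero y hy := min_eq_left hy.1
  right_one x hx := min_eq_left hx.2
  left_one y hy := min_eq_right hy.2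
  two_increasing x₁ _ x₂ _ y₁ _ y₂ _ hx hy := by
    rcases min_cases x₁ y₁ with h₁ | h₁ <;> rcases min_cases x₂ y₂ with h₂ | h₂ <;>
      linarith [min_le_left x₂ y₁, min_le_right x₂ y₁, min_le_left x₁ y₂, min_le_right x₁ y₂]

/-! ### Integrals along the diagonal and the antidiagonal -/

/-- The squared positive part is differentiable even at 0, so it yields a primitive of the positive
part without splitting intervals. -/
theorem hasDerivAt_sq_max_zero (x : ℝ) : HasDerivAt (fun y : ℝ => max y 0 ^ 2) (2 * max x 0) x := by
  rcases lt_trichotomy x 0 with h | rfl | h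
  · rw [max_eq_right h.le, mul_zero]
    refine (hasDerivAt_const x (0 : ℝ)).congr_of_eventuallyEq ?_
    filter_upwards [gt_mem_nhds h] with y hy
    simp [max_eq_right (le_of_lt hy)]
  · rw [← hasDerivWithinAt_univ, ← Iic_union_Ici (a := (0 : ℝ))]
    refine HasDerivWithinAt.union ?_ ?_
    · refine (hasDerivWithinAt_const (0 : ℝ) (Iic 0) (0 : ℝ)).congr_of_mem ?_ self_mem_Iic
        |>.congr_deriv (by simp)
      intro y hy
      simp [max_eq_right (mem_Iic.1 hy)]
    · refine ((hasDerivAt_pow 2 (0 : ℝ)).hasDerivWithinAt (s := Ici 0)).congr_of_mem ?_ self_mem_Ici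
        |>.congr_deriv (by simp)
      intro y hy
      simp [max_eq_left (mem_Ici.1 hy)]
  · rw [max_eq_left h.le]
    refine (hasDerivAt_pow 2 x).congr_of_eventuallyEq ?_ |>.congr_deriv (by simp)
    filter_upwards [lt_mem_nhds h] with y hy
    simp [max_eq_left (le_of_lt hy)]

theorem integral_max_sub_zero (a p q : ℝ) :
    ∫ u in p..q, max (a - u) 0 = (max (a - p) 0 ^ 2 - max (a - q) 0 ^ 2) / 2 := by
  have h : ∀ x ∈ uIcc p q, HasDerivAt (fun u => -(max (a - u) 0 ^ 2 / 2)) (max (a - x) 0) x :=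
    fun x _ => by
      refine (((hasDerivAt_sq_max_zero (a - x)).comp x
        ((hasDerivAt_id x).const_sub a)).div_const 2).neg.congr_deriv ?_
      ring
  rw [intervalIntegral.integral_eq_sub_of_hasDerivAt h
    (Continuous.intervalIntegrable (by fun_prop) _ _)]
  ring

theorem integral_max_zero_sub (c p q : ℝ) :
    ∫ u in p..q, max (u - c) 0 = (max (q - c) 0 ^ 2 - max (p - c) 0 ^ 2) / 2 := by
  have := intervalIntegral.integral_comp_neg (a := p) (b := q) (fun u => max (-c - u) 0)
  simp only [sub_neg_eq_add, neg_add_eq_sub] at this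
  rw [this, integral_max_sub_zero]
  ring_nf

/-- The integral of the maximum of `0`, `2 u - 1` and a kinked increasing function, when the
latter exceeds the former two exactly between `p` and `q`. -/
theorem integral_diag_of_crossing {θ a b p q : ℝ} (hp₀ : 0 ≤ p) (hp : p ≤ 1 / 2) (hq : 1 / 2 ≤ q)
    (hq₁ : q ≤ 1) (hgp : θ - max (a - p) 0 - max (b - p) 0 = 0)
    (hgq : θ - max (a - q) 0 - max (b - q) 0 = 2 * q - 1) :
    ∫ u in (0 : ℝ)..1, minCopulaAt θ a b u u =
      θ * (q - p) - (max (a - p) 0 ^ 2 - max (a - q) 0 ^ 2) / 2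
        - (max (b - p) 0 ^ 2 - max (b - q) 0 ^ 2) / 2 + q - q ^ 2 := by
  have hc : Continuous fun u => minCopulaAt θ a b u u := by unfold minCopulaAt; fun_prop
  -- The kinked function is increasing, which decides its sign on either side of p, and has slope at
  -- most 2, which decides its comparison with 2u - 1 on either side of q.
  have mono : ∀ c x y : ℝ, x ≤ y → max (c - y) 0 ≤ max (c - x) 0 := fun c x y h =>
    max_le_max (by linarith) le_rfl
  have lip : ∀ c x y : ℝ, x ≤ y → max (c - x) 0 ≤ max (c - y) 0 + (y - x) := fun c x y h =>
    max_le (by linarith [le_max_left (c - y) 0]) (by linarith [le_max_right (c - y) 0])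
  have e₁ : ∫ u in (0 : ℝ)..p, minCopulaAt θ a b u u = ∫ u in (0 : ℝ)..p, (0 : ℝ) := by
    refine intervalIntegral.integral_congr fun u hu => ?_
    rw [uIcc_of_le hp₀] at hu
    have := mono a u p hu.2
    have := mono b u p hu.2
    simp only [minCopulaAt]
    rw [max_eq_left (show u + u - 1 ≤ 0 by linarith [hu.2]), max_eq_left (by linarith)]
  have e₂ : ∫ u in p..q, minCopulaAt θ a b u u =
      ∫ u in p..q, (θ - max (a - u) 0 - max (b - u) 0) := by
    refine intervalIntegral.integral_congr fun u hu => ?_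
    rw [uIcc_of_le (by linarith)] at hu
    have := mono a p u hu.1
    have := mono b p u hu.1
    have := lip a u q hu.2
    have := lip b u q hu.2
    simp only [minCopulaAt]
    rw [max_eq_right]
    exact max_le (by linarith) (by linarith)
  have e₃ : ∫ u in q..1, minCopulaAt θ a b u u = ∫ u in q..1, (2 * u - 1) := by
    refine intervalIntegral.integral_congr fun u hu => ?_
    rw [uIcc_of_le hq₁] at hu
    have := lip a q u hu.1
    have := lip b q u hu.1
    simp only [minCopulaAt]
    rw [max_eq_right (show 0 ≤ u + u - 1 by linarith [hu.1]), max_eq_left (by linarith)]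
    ring
  have hi : ∀ x y, IntervalIntegrable (fun u => minCopulaAt θ a b u u) MeasureTheory.volume x y :=
    fun x y => hc.intervalIntegrable x y
  have hi' : ∀ c : ℝ, IntervalIntegrable (fun u => max (c - u) 0) MeasureTheory.volume p q :=
    fun c => Continuous.intervalIntegrable (by fun_prop) p q
  rw [← intervalIntegral.integral_add_adjacent_intervals (hi 0 q) (hi q 1),
    ← intervalIntegral.integral_add_adjacent_intervals (hi 0 p) (hi p q), e₁, e₂, e₃,
    intervalIntegral.integral_sub (intervalIntegrable_const.sub (hi' a)) (hi' b),
    intervalIntegral.integral_sub intervalIntegrable_const (hi' a), integral_max_sub_zero,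
    integral_max_sub_zero, intervalIntegral.integral_sub (Continuous.intervalIntegrable (by fun_prop) _ _)
      intervalIntegrable_const,
    intervalIntegral.integral_const_mul]
  simp only [integral_id, intervalIntegral.integral_const, smul_eq_mul]
  ring

theorem integral_diag_frechetLower : ∫ u in (0 : ℝ)..1, max 0 (u + u - 1) = 1 / 4 := by
  have h : ∀ u : ℝ, max 0 (u + u - 1) = 2 * max (u - 1 / 2) 0 := fun u => by
    rw [max_comm]
    rcases max_cases (u - 1 / 2) 0 with h | h
    · rw [max_eq_left (by linarith)]; linarith
    · rw [max_eq_right (by linarith)]; linarith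
  simp_rw [h, intervalIntegral.integral_const_mul, integral_max_zero_sub]
  norm_num

/-- For θ ≤ a - 1/2 the kinked function never rises above the Fréchet bound on the diagonal.
Otherwise it crosses 0 at p = a - θ or (a + b - θ)/2, according to whether p ≥ b, and crosses 2u - 1
at q = θ - a + 1 or (1 + θ)/2, according to whether q ≤ a. -/
theorem integral_diag_minCopulaAt {θ a b : ℝ} (ha : a ≤ 1) (h₀ : 0 ≤ θ) (hs : a + b - 1 ≤ θ)
    (hba : b ≤ a) (hθ : θ ≤ b) :
    ∫ u in (0 : ℝ)..1, minCopulaAt θ a b u u =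
      1 / 4 + max (θ - a + 1 / 2) 0 ^ 2 - max (θ - 2 * a + 1) 0 ^ 2 / 4
        - max (θ - a + b) 0 ^ 2 / 4 := by
  rcases le_total θ (a - 1 / 2) with h₁ | h₁
  · have e : ∫ u in (0 : ℝ)..1, minCopulaAt θ a b u u =
        ∫ u in (0 : ℝ)..1, max 0 (u + u - 1) := by
      refine intervalIntegral.integral_congr fun u _ => ?_
      simp only [minCopulaAt]
      refine max_eq_left ?_
      rcases le_total u (1 / 2) with h | h
      · exact le_max_of_le_left (by linarith [le_max_left (a - u) 0, le_max_right (b - u) 0])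
      · refine le_max_of_le_right ?_
        linarith [le_max_left (a - u) 0, le_max_right (b - u) 0]
    rw [e, integral_diag_frechetLower, max_eq_right (show θ - a + 1 / 2 ≤ 0 by linarith),
      max_eq_right (show θ - 2 * a + 1 ≤ 0 by linarith),
      max_eq_right (show θ - a + b ≤ 0 by linarith)]
    ring
  rw [max_eq_left (show 0 ≤ θ - a + 1 / 2 by linarith)]
  rcases le_total θ (a - b) with h₂ | h₂ <;> rcases le_total θ (2 * a - 1) with h₃ | h₃
  · rw [max_eq_right (show θ - 2 * a + 1 ≤ 0 by linarith),
      max_eq_right (show θ - a + b ≤ 0 by linarith)]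
    have e₁ : max (a - (a - θ)) 0 = θ := by rw [max_eq_left (by linarith)]; ring
    have e₂ : max (b - (a - θ)) 0 = 0 := max_eq_right (by linarith)
    have e₃ : max (a - (θ - a + 1)) 0 = 2 * a - 1 - θ := by rw [max_eq_left (by linarith)]; ring
    have e₄ : max (b - (θ - a + 1)) 0 = 0 := max_eq_right (by linarith)
    rw [integral_diag_of_crossing (p := a - θ) (q := θ - a + 1) (by linarith) (by linarith)
      (by linarith) (by linarith) (by rw [e₁, e₂]; ring) (by rw [e₃, e₄]; ring), e₁, e₂, e₃, e₄]
    ring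
  · rw [max_eq_left (show 0 ≤ θ - 2 * a + 1 by linarith),
      max_eq_right (show θ - a + b ≤ 0 by linarith)]
    have e₁ : max (a - (a - θ)) 0 = θ := by rw [max_eq_left (by linarith)]; ring
    have e₂ : max (b - (a - θ)) 0 = 0 := max_eq_right (by linarith)
    have e₃ : max (a - (1 + θ) / 2) 0 = 0 := max_eq_right (by linarith)
    have e₄ : max (b - (1 + θ) / 2) 0 = 0 := max_eq_right (by linarith)
    rw [integral_diag_of_crossing (p := a - θ) (q := (1 + θ) / 2) (by linarith) (by linarith)
      (by linarith) (by linarith) (by rw [e₁, e₂]; ring) (by rw [e₃, e₄]; ring), e₁, e₂, e₃, e₄]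
    ring
  · rw [max_eq_right (show θ - 2 * a + 1 ≤ 0 by linarith),
      max_eq_left (show 0 ≤ θ - a + b by linarith)]
    have e₁ : max (a - (a + b - θ) / 2) 0 = (a - b + θ) / 2 := by
      rw [max_eq_left (by linarith)]; ring
    have e₂ : max (b - (a + b - θ) / 2) 0 = (b - a + θ) / 2 := by
      rw [max_eq_left (by linarith)]; ring
    have e₃ : max (a - (θ - a + 1)) 0 = 2 * a - 1 - θ := by rw [max_eq_left (by linarith)]; ring
    have e₄ : max (b - (θ - a + 1)) 0 = 0 := max_eq_right (by linarith)
    rw [integral_diag_of_crossing (p := (a + b - θ) / 2) (q := θ - a + 1) (by linarith)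
      (by linarith) (by linarith) (by linarith) (by rw [e₁, e₂]; ring) (by rw [e₃, e₄]; ring),
      e₁, e₂, e₃, e₄]
    ring
  · rw [max_eq_left (show 0 ≤ θ - 2 * a + 1 by linarith),
      max_eq_left (show 0 ≤ θ - a + b by linarith)]
    have e₁ : max (a - (a + b - θ) / 2) 0 = (a - b + θ) / 2 := by
      rw [max_eq_left (by linarith)]; ring
    have e₂ : max (b - (a + b - θ) / 2) 0 = (b - a + θ) / 2 := by
      rw [max_eq_left (by linarith)]; ring
    have e₃ : max (a - (1 + θ) / 2) 0 = 0 := max_eq_right (by linarith)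
    have e₄ : max (b - (1 + θ) / 2) 0 = 0 := max_eq_right (by linarith)
    rw [integral_diag_of_crossing (p := (a + b - θ) / 2) (q := (1 + θ) / 2) (by linarith)
      (by linarith) (by linarith) (by linarith) (by rw [e₁, e₂]; ring) (by rw [e₃, e₄]; ring),
      e₁, e₂, e₃, e₄]
    ring

/-- The graph is a trapezoid with slopes ±1 over [a - θ, 1 - b + θ]. Its height and mean width are θ
and θ - (a + b - 1), in an order depending on the sign of a + b - 1. -/
theorem integral_antidiag_minCopulaAt {θ a b : ℝ} (h₀ : 0 ≤ θ) (hs : a + b - 1 ≤ θ)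
    (hθa : θ ≤ a) (hθb : θ ≤ b) :
    ∫ u in (0 : ℝ)..1, minCopulaAt θ a b u (1 - u) = θ * (θ - (a + b - 1)) := by
  have hc : Continuous fun u => minCopulaAt θ a b u (1 - u) := by unfold minCopulaAt; fun_prop
  have hi : ∀ x y, IntervalIntegrable (fun u => minCopulaAt θ a b u (1 - u))
    MeasureTheory.volume x y := fun x y => hc.intervalIntegrable x y
  have e : ∀ u, minCopulaAt θ a b u (1 - u) =
      max 0 (θ - max (a - u) 0 - max (u - (1 - b)) 0) := fun u => by
    simp only [minCopulaAt]
    rw [show u + (1 - u) - 1 = 0 by ring, max_self, show b - (1 - u) = u - (1 - b) by ring]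
  have e₁ : ∫ u in (0 : ℝ)..(a - θ), minCopulaAt θ a b u (1 - u) =
      ∫ u in (0 : ℝ)..(a - θ), (0 : ℝ) := by
    refine intervalIntegral.integral_congr fun u hu => ?_
    rw [uIcc_of_le (by linarith)] at hu
    simp only [e]
    exact max_eq_left
      (by linarith [hu.2, le_max_left (a - u) 0, le_max_right (u - (1 - b)) 0])
  have e₂ : ∫ u in (a - θ)..(1 - b + θ), minCopulaAt θ a b u (1 - u) =
      ∫ u in (a - θ)..(1 - b + θ), (θ - max (a - u) 0 - max (u - (1 - b)) 0) := by
    refine intervalIntegral.integral_congr fun u hu => ?_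
    rw [uIcc_of_le (by linarith)] at hu
    simp only [e]
    refine max_eq_right ?_
    rcases max_cases (a - u) 0 with h | h <;> rcases max_cases (u - (1 - b)) 0 with h' | h' <;>
      linarith [hu.1, hu.2]
  have e₃ : ∫ u in (1 - b + θ)..1, minCopulaAt θ a b u (1 - u) =
      ∫ u in (1 - b + θ)..1, (0 : ℝ) := by
    refine intervalIntegral.integral_congr fun u hu => ?_
    rw [uIcc_of_le (by linarith)] at hu
    simp only [e]
    exact max_eq_left
      (by linarith [hu.1, le_max_right (a - u) 0, le_max_left (u - (1 - b)) 0])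
  have i₁ : IntervalIntegrable (fun u => max (a - u) 0) MeasureTheory.volume
    (a - θ) (1 - b + θ) := Continuous.intervalIntegrable (by fun_prop) _ _
  have i₂ : IntervalIntegrable (fun u => max (u - (1 - b)) 0) MeasureTheory.volume
    (a - θ) (1 - b + θ) := Continuous.intervalIntegrable (by fun_prop) _ _
  rw [← intervalIntegral.integral_add_adjacent_intervals (hi 0 (1 - b + θ)) (hi _ 1),
    ← intervalIntegral.integral_add_adjacent_intervals (hi 0 (a - θ)) (hi _ _), e₁, e₂, e₃,
    intervalIntegral.integral_sub (intervalIntegrable_const.sub i₁) i₂,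
    intervalIntegral.integral_sub intervalIntegrable_const i₁, integral_max_sub_zero,
    integral_max_zero_sub, max_eq_left (show 0 ≤ a - (a - θ) by linarith),
    max_eq_right (show a - (1 - b + θ) ≤ 0 by linarith),
    max_eq_left (show 0 ≤ 1 - b + θ - (1 - b) by linarith),
    max_eq_right (show a - θ - (1 - b) ≤ 0 by linarith)]
  simp only [intervalIntegral.integral_const, smul_eq_mul]
  ring

theorem giniGamma_min : giniGamma (fun x y => min x y) = 1 := by
  have h : ∀ u : ℝ, min u (1 - u) = u - 2 * max (u - 1 / 2) 0 := fun u => by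
    rcases max_cases (u - 1 / 2) 0 with h | h
    · rw [min_eq_right (by linarith)]; linarith
    · rw [min_eq_left (by linarith)]; linarith
  rw [isCopula_min.giniGamma_eq]
  simp_rw [h, min_self]
  rw [intervalIntegral.integral_sub intervalIntegral.intervalIntegrable_id
    (Continuous.intervalIntegrable (by fun_prop) _ _), intervalIntegral.integral_const_mul,
    integral_max_zero_sub]
  simp only [integral_id]
  norm_num

/-! ### The least gamma as a function of θ -/

/-- For `b ≤ a`, Gini's gamma of the smallest copula with the value `θ` at `(a, b)`. -/
noncomputable def minGini (a b θ : ℝ) : ℝ :=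
  4 * (θ * (θ - (a + b - 1))) - 1 + (4 * max (θ - a + 1 / 2) 0 ^ 2
    - max (θ - 2 * a + 1) 0 ^ 2 - max (θ - a + b) 0 ^ 2)

theorem giniGamma_minCopulaAt {θ a b : ℝ} (ha : a ≤ 1) (h₀ : 0 ≤ θ) (hs : a + b - 1 ≤ θ)
    (hba : b ≤ a) (hθ : θ ≤ b) : giniGamma (minCopulaAt θ a b) = minGini a b θ := by
  rw [(isCopula_minCopulaAt ha (hθ.trans hba) hθ).giniGamma_eq,
    integral_diag_minCopulaAt ha h₀ hs hba hθ,
    integral_antidiag_minCopulaAt h₀ hs (hθ.trans hba) hθ, minGini]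
  ring

theorem continuous_minGini (a b : ℝ) : Continuous (minGini a b) := by
  unfold minGini; fun_prop

/-- Put x = θ - a + 1/2. Both subtracted squares in `minGini` have bases 2x - k, with k = θ or k = θ
- (a + b - 1), and x and k grow with θ at rate 1. As 2x - k ≤ 2x, each grows at most half as fast as
the term 4 max(x, 0)², which thus absorbs both. -/
theorem sq_max_zero_sub_le {x d k : ℝ} (hk : 0 ≤ k) (hd : 0 ≤ d) :
    max (2 * (x + d) - (k + d)) 0 ^ 2 - max (2 * x - k) 0 ^ 2 ≤
      2 * (max (x + d) 0 ^ 2 - max x 0 ^ 2) := by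
  rcases max_cases (2 * (x + d) - (k + d)) 0 with ⟨e₁, h₁⟩ | ⟨e₁, h₁⟩ <;>
    rcases max_cases (2 * x - k) 0 with ⟨e₂, h₂⟩ | ⟨e₂, h₂⟩ <;>
    rcases max_cases (x + d) 0 with ⟨e₃, h₃⟩ | ⟨e₃, h₃⟩ <;>
    rcases max_cases x 0 with ⟨e₄, h₄⟩ | ⟨e₄, h₄⟩ <;>
    rw [e₁, e₂, e₃, e₄] <;> nlinarith

theorem minGini_strictMonoOn (a b : ℝ) : StrictMonoOn (minGini a b) (Ici (max 0 (a + b - 1))) := by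
  intro θ hθ θ' _ h
  obtain ⟨h₀, hs⟩ := max_le_iff.1 (mem_Ici.1 hθ)
  have h₁ := sq_max_zero_sub_le (x := θ - a + 1 / 2) (d := θ' - θ) h₀ (by linarith)
  have h₂ := sq_max_zero_sub_le (x := θ - a + 1 / 2) (d := θ' - θ) (sub_nonneg.2 hs) (by linarith)
  have h₃ : θ * (θ - (a + b - 1)) < θ' * (θ' - (a + b - 1)) := by nlinarith
  unfold minGini
  ring_nf at h₁ h₂ h₃ ⊢
  linarith

/-- At the Fréchet bound one of the two shifts k is 0, so that subtracted square cancels the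
positive one; the other vanishes. -/
theorem minGini_frechetLower {a b : ℝ} (hba : b ≤ a) :
    minGini a b (max 0 (a + b - 1)) = -1 := by
  unfold minGini
  rcases max_cases 0 (a + b - 1) with ⟨e, h⟩ | ⟨e, h⟩ <;> rw [e]
  · rw [max_eq_right (show 0 - a + b ≤ 0 by linarith)]
    rcases max_cases (0 - a + 1 / 2) 0 with ⟨e₁, h₁⟩ | ⟨e₁, h₁⟩
    · rw [e₁, max_eq_left (by linarith)]; ring
    · rw [e₁, max_eq_right (by linarith)]; ring
  · rw [max_eq_right (show a + b - 1 - 2 * a + 1 ≤ 0 by linarith)]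
    rcases max_cases (a + b - 1 - a + 1 / 2) 0 with ⟨e₁, h₁⟩ | ⟨e₁, h₁⟩
    · rw [e₁, max_eq_left (by linarith)]; ring
    · rw [e₁, max_eq_right (by linarith)]; ring

/-- The point 2 is merely large enough to make all positive parts active; it only serves as upper
end for the intermediate value theorem. -/
theorem one_le_minGini_two {a b : ℝ} (ha : a ≤ 1) (hb : b ≤ 1) (hba : b ≤ a) (hb₀ : 0 ≤ b) :
    1 ≤ minGini a b 2 := by
  unfold minGini
  rw [max_eq_left (by linarith), max_eq_left (by linarith), max_eq_left (by linarith)]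
  nlinarith [mul_nonneg (sub_nonneg.2 hba) (show 0 ≤ 1 - a + b by linarith)]

/-- The equation `γ = t` has a unique solution above the lower Fréchet bound. -/
theorem exists_minGini_eq {a b t : ℝ} (ha : a ≤ 1) (hba : b ≤ a) (hb₀ : 0 ≤ b)
    (ht : t ∈ Icc (-1 : ℝ) 1) : ∃ θ, max 0 (a + b - 1) ≤ θ ∧ minGini a b θ = t := by
  have hle : max 0 (a + b - 1) ≤ 2 := max_le (by norm_num) (by linarith)
  obtain ⟨θ, hθ, h⟩ := intermediate_value_Icc hle (continuous_minGini a b).continuousOn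
    (show t ∈ Icc (minGini a b (max 0 (a + b - 1))) (minGini a b 2) from
      ⟨(minGini_frechetLower hba).trans_le ht.1,
        ht.2.trans (one_le_minGini_two ha (hba.trans ha) hba hb₀)⟩)
  exact ⟨θ, hθ.1, h⟩

theorem eq_of_minGini_eq {a b t θ y : ℝ} (hy : max 0 (a + b - 1) ≤ y) (hyt : minGini a b y = t)
    (hθ : max 0 (a + b - 1) ≤ θ) (hθt : minGini a b θ = t) : θ = y :=
  (minGini_strictMonoOn a b).injOn hθ hy (hθt.trans hyt.symm)

/-! ### The five quadratic pieces and their roots -/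

section Branches

variable {a b θ : ℝ}

/-- Once θ - a + 1/2 ≤ 0, the bounds on θ make the other two positive parts vanish too; hence five
sign patterns rather than eight. -/
theorem minGini_branch₁ (h₀ : 0 ≤ θ) (hs : a + b - 1 ≤ θ) (h : 1 / 2 + θ ≤ a) :
    minGini a b θ = 4 * (θ * (θ - (a + b - 1))) - 1 := by
  unfold minGini
  rw [max_eq_right (by linarith), max_eq_right (by linarith), max_eq_right (by linarith)]
  ring

theorem minGini_branch₂ (h₁ : b + θ ≤ a) (h₂ : (1 + θ) / 2 ≤ a) (h₃ : a ≤ 1 / 2 + θ) :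
    minGini a b θ = 4 * (θ * (θ - (a + b - 1))) - 1 + 4 * (θ - a + 1 / 2) ^ 2 := by
  unfold minGini
  rw [max_eq_left (by linarith), max_eq_right (by linarith), max_eq_right (by linarith)]
  ring

theorem minGini_branch₃ (h₀ : 0 ≤ θ) (h₁ : b + θ ≤ a) (h₂ : a ≤ (1 + θ) / 2) :
    minGini a b θ = 4 * (θ * (θ - (a + b - 1))) - 1 + 4 * (θ - a + 1 / 2) ^ 2
      - (θ - 2 * a + 1) ^ 2 := by
  unfold minGini
  rw [max_eq_left (by linarith), max_eq_left (by linarith), max_eq_right (by linarith)]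
  ring

theorem minGini_branch₄ (hs : a + b - 1 ≤ θ) (h₁ : (1 + θ) / 2 ≤ a) (h₂ : a ≤ b + θ) :
    minGini a b θ = 4 * (θ * (θ - (a + b - 1))) - 1 + 4 * (θ - a + 1 / 2) ^ 2
      - (θ - a + b) ^ 2 := by
  unfold minGini
  rw [max_eq_left (by linarith), max_eq_right (by linarith), max_eq_left (by linarith)]
  ring

theorem minGini_branch₅ (h₀ : 0 ≤ θ) (h₁ : a ≤ b + θ) (h₂ : a ≤ (1 + θ) / 2) :
    minGini a b θ = 4 * (θ * (θ - (a + b - 1))) - 1 + 4 * (θ - a + 1 / 2) ^ 2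
      - (θ - 2 * a + 1) ^ 2 - (θ - a + b) ^ 2 := by
  unfold minGini
  rw [max_eq_left (by linarith), max_eq_left (by linarith), max_eq_left (by linarith)]
  ring

theorem branch_cases (a b θ : ℝ) : 1 / 2 + θ ≤ a ∨
    (b + θ ≤ a ∧ (1 + θ) / 2 ≤ a ∧ a ≤ 1 / 2 + θ) ∨ (b + θ ≤ a ∧ a ≤ (1 + θ) / 2) ∨
    ((1 + θ) / 2 ≤ a ∧ a ≤ b + θ) ∨ (a ≤ b + θ ∧ a ≤ (1 + θ) / 2) := by
  rcases le_total (1 / 2 + θ) a with h | h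
  · exact Or.inl h
  · rcases le_total (b + θ) a with h₁ | h₁ <;> rcases le_total ((1 + θ) / 2) a with h₂ | h₂ <;>
      simp only [h, h₁, h₂, true_and, and_true, true_or, or_true]

end Branches

section Roots

variable {t a b : ℝ}

theorem eq_of_sq_eq {x r : ℝ} (hx : 0 ≤ x) (h : x ^ 2 = r) : √r = x := by
  rw [← h, Real.sqrt_sq hx]

/-- Here and for the other branches, the square root equals a positive multiple of the θ-derivative
of the quadratic. The inequalities on θ make it nonnegative, which selects the larger root. -/
theorem giniTheta1_eq {θ : ℝ} (h₀ : 0 ≤ θ) (hs : a + b - 1 ≤ θ)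
    (h : 4 * (θ * (θ - (a + b - 1))) - 1 = t) : giniTheta1 t a b = θ := by
  rw [giniTheta1, eq_of_sq_eq (x := 2 * θ - (a + b - 1)) (by linarith) (by linear_combination h)]
  ring

theorem giniTheta2_eq {θ : ℝ} (hba : b ≤ a) (h₀ : 0 ≤ θ) (hs : a + b - 1 ≤ θ)
    (h₃ : a ≤ 1 / 2 + θ)
    (h : 4 * (θ * (θ - (a + b - 1))) - 1 + 4 * (θ - a + 1 / 2) ^ 2 = t) :
    giniTheta2 t a b = θ := by
  rw [giniTheta2, max_eq_left hba, min_eq_right hba,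
    eq_of_sq_eq (x := 4 * θ - 3 * a - b + 2) (by linarith) (by linear_combination 2 * h)]
  ring

theorem giniTheta3_eq {θ : ℝ} (hba : b ≤ a) (h₀ : 0 ≤ θ) (hs : a + b - 1 ≤ θ)
    (h₂ : a ≤ (1 + θ) / 2)
    (h : 4 * (θ * (θ - (a + b - 1))) - 1 + 4 * (θ - a + 1 / 2) ^ 2 - (θ - 2 * a + 1) ^ 2 = t) :
    giniTheta3 t a b = θ := by
  rw [giniTheta3, max_eq_left hba, min_eq_right hba,
    eq_of_sq_eq (x := 7 * θ - 4 * a - 2 * b + 3) (by linarith) (by linear_combination 7 * h)]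
  ring

theorem giniTheta4_eq {θ : ℝ} (hba : b ≤ a) (h₀ : 0 ≤ θ) (hs : a + b - 1 ≤ θ)
    (h₂ : a ≤ b + θ)
    (h : 4 * (θ * (θ - (a + b - 1))) - 1 + 4 * (θ - a + 1 / 2) ^ 2 - (θ - a + b) ^ 2 = t) :
    giniTheta4 t a b = θ := by
  rw [giniTheta4, max_eq_left hba, min_eq_right hba,
    eq_of_sq_eq (x := 7 * θ - 5 * a - 3 * b + 4) (by linarith) (by linear_combination 7 * h)]
  ring

theorem giniTheta5_eq {θ : ℝ} (h₀ : 0 ≤ θ) (hs : a + b - 1 ≤ θ)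
    (h : 4 * (θ * (θ - (a + b - 1))) - 1 + 4 * (θ - a + 1 / 2) ^ 2 - (θ - 2 * a + 1) ^ 2
      - (θ - a + b) ^ 2 = t) :
    giniTheta5 t a b = θ := by
  rw [giniTheta5, eq_of_sq_eq (x := 6 * θ - 3 * (a + b - 1)) (by linarith)
    (by linear_combination 6 * h)]
  ring

theorem giniTheta1_root (ht : -1 ≤ t) : 4 * (giniTheta1 t a b * (giniTheta1 t a b -
    (a + b - 1))) - 1 = t := by
  have h := Real.sq_sqrt (show 0 ≤ (a + b - 1) ^ 2 + t + 1 by nlinarith)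
  rw [giniTheta1]
  linear_combination h

theorem giniTheta2_root (hba : b ≤ a) (h : 0 ≤ (a + b) ^ 2 + 4 * (1 - a) * (1 - b) + 2 * t) :
    4 * (giniTheta2 t a b * (giniTheta2 t a b - (a + b - 1))) - 1
      + 4 * (giniTheta2 t a b - a + 1 / 2) ^ 2 = t := by
  have h := Real.sq_sqrt h
  rw [giniTheta2, max_eq_left hba, min_eq_right hba]
  linear_combination h / 2

theorem giniTheta3_root (hba : b ≤ a) (ht : -1 ≤ t) :
    4 * (giniTheta3 t a b * (giniTheta3 t a b - (a + b - 1))) - 1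
      + 4 * (giniTheta3 t a b - a + 1 / 2) ^ 2 - (giniTheta3 t a b - 2 * a + 1) ^ 2 = t := by
  have h := Real.sq_sqrt (show 0 ≤ 16 * a ^ 2 + 4 * b ^ 2 - 24 * a - 12 * b + 16 * a * b
    + 7 * t + 16 by nlinarith [sq_nonneg (4 * a + 2 * b - 3)])
  rw [giniTheta3, max_eq_left hba, min_eq_right hba]
  linear_combination h / 7

theorem giniTheta4_root (hba : b ≤ a) (ht : -1 ≤ t) :
    4 * (giniTheta4 t a b * (giniTheta4 t a b - (a + b - 1))) - 1
      + 4 * (giniTheta4 t a b - a + 1 / 2) ^ 2 - (giniTheta4 t a b - a + b) ^ 2 = t := by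
  have h := Real.sq_sqrt (show 0 ≤ 4 * a ^ 2 + 16 * b ^ 2 - 12 * a - 24 * b + 16 * a * b
    + 7 * t + 16 by nlinarith [sq_nonneg (2 * a + 4 * b - 3)])
  rw [giniTheta4, max_eq_left hba, min_eq_right hba]
  linear_combination h / 7

theorem giniTheta5_root (ht : -1 ≤ t) :
    4 * (giniTheta5 t a b * (giniTheta5 t a b - (a + b - 1))) - 1
      + 4 * (giniTheta5 t a b - a + 1 / 2) ^ 2 - (giniTheta5 t a b - 2 * a + 1) ^ 2
      - (giniTheta5 t a b - a + b) ^ 2 = t := by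
  have h := Real.sq_sqrt (show 0 ≤ 3 * (5 * a ^ 2 + 5 * b ^ 2 - 6 * a - 6 * b + 2 * a * b
    + 2 * t + 5) by nlinarith [sq_nonneg (a + b - 1), sq_nonneg (a - b)])
  rw [giniTheta5]
  linear_combination h / 6

end Roots

/-! ### The maximum of the branches is the solution of γ = t -/

/-- The maximum of the branches `χ_{θ_i} θ_i`. -/
noncomputable def giniBranchMax (t u v : ℝ) : ℝ :=
  max (charFn (giniRegion1 t) u v * giniTheta1 t u v)
    (max (charFn (giniRegion2 t) u v * giniTheta2 t u v)
      (max (charFn (giniRegion3 t) u v * giniTheta3 t u v)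
        (max (charFn (giniRegion4 t) u v * giniTheta4 t u v)
          (charFn (giniRegion5 t) u v * giniTheta5 t u v))))

theorem charFn_mul_of_mem {S : Set (ℝ × ℝ)} {u v : ℝ} (h : (u, v) ∈ S) (x : ℝ) :
    charFn S u v * x = x := by
  rw [charFn, indicator_of_mem h, one_mul]

theorem charFn_mul_le {S : Set (ℝ × ℝ)} {u v x y : ℝ} (hy : 0 ≤ y) (h : (u, v) ∈ S → x ≤ y) :
    charFn S u v * x ≤ y := by
  by_cases hS : (u, v) ∈ S
  · rw [charFn_mul_of_mem hS]; exact h hS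
  · rw [charFn, indicator_of_notMem hS, zero_mul]; exact hy

theorem giniBranchMax_eq {t a b y : ℝ} (ht : -1 ≤ t) (ha : a ∈ Icc (0 : ℝ) 1)
    (hb : b ∈ Icc (0 : ℝ) 1) (hba : b ≤ a) (hy : max 0 (a + b - 1) ≤ y)
    (hyt : minGini a b y = t) : giniBranchMax t a b = y := by
  obtain ⟨h₀, hs⟩ := max_le_iff.1 hy
  have hmem : (a, b) ∈ Icc (0 : ℝ) 1 ×ˢ Icc (0 : ℝ) 1 := ⟨ha, hb⟩
  -- A point may lie in R_i with θ_i below the Fréchet bound; then θ_i ≤ y trivially. Otherwise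
  -- uniqueness of the solution gives θ_i = y.
  have key : ∀ θ : ℝ, (0 ≤ θ → a + b - 1 ≤ θ → minGini a b θ = t) → θ ≤ y := fun θ h => by
    rcases le_total θ (max 0 (a + b - 1)) with h' | h'
    · exact h'.trans hy
    · obtain ⟨h₁, h₂⟩ := max_le_iff.1 h'
      exact (eq_of_minGini_eq hy hyt h' (h h₁ h₂)).le
  apply le_antisymm
  · refine max_le ?_ (max_le ?_ (max_le ?_ (max_le ?_ ?_))) <;>
      refine charFn_mul_le h₀ fun hR => key _ fun h₁ h₂ => ?_
    · simp only [giniRegion1, mem_ofPred_eq, max_eq_left hba] at hR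
      rw [minGini_branch₁ h₁ h₂ hR.2, giniTheta1_root ht]
    · simp only [giniRegion2, mem_ofPred_eq, max_eq_left hba, min_eq_right hba] at hR
      obtain ⟨-, h, h₅⟩ := hR
      obtain ⟨h₃, h₄⟩ := max_le_iff.1 h
      rcases le_or_gt 0 ((a + b) ^ 2 + 4 * (1 - a) * (1 - b) + 2 * t) with hr | hr
      · rw [minGini_branch₂ h₃ h₄ h₅, giniTheta2_root hba hr]
      -- With the root read as 0, the inequalities of R₂ and θ₂ ≥ 0 force a = b = 1/2, where the
      -- radicand is 2 + 2t ≥ 0, a contradiction.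
      · have e : giniTheta2 t a b = (3 * a + b - 2) / 4 := by
          rw [giniTheta2, Real.sqrt_eq_zero_of_nonpos hr.le, max_eq_left hba, min_eq_right hba,
            add_zero]
        rw [e] at h₁ h₂ h₃ h₅
        have hab : a = b := by linarith
        subst hab
        nlinarith
    · simp only [giniRegion3, mem_ofPred_eq, max_eq_left hba, min_eq_right hba] at hR
      rw [minGini_branch₃ h₁ hR.2.1 hR.2.2, giniTheta3_root hba ht]
    · simp only [giniRegion4, mem_ofPred_eq, max_eq_left hba, min_eq_right hba] at hR
      rw [minGini_branch₄ h₂ hR.2.1 hR.2.2, giniTheta4_root hba ht]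
    · simp only [giniRegion5, mem_ofPred_eq, max_eq_left hba, min_eq_right hba, le_min_iff] at hR
      rw [minGini_branch₅ h₁ hR.2.1 hR.2.2, giniTheta5_root ht]
  · rcases branch_cases a b y with h | ⟨h₁, h₂, h₃⟩ | ⟨h₁, h₂⟩ | ⟨h₁, h₂⟩ | ⟨h₁, h₂⟩
    · have e := giniTheta1_eq h₀ hs ((minGini_branch₁ h₀ hs h).symm.trans hyt)
      refine le_max_of_le_left (le_of_eq ?_)
      rw [charFn_mul_of_mem, e]
      simp only [giniRegion1, mem_ofPred_eq, max_eq_left hba, e]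
      exact ⟨hmem, h⟩
    · have e := giniTheta2_eq hba h₀ hs h₃ ((minGini_branch₂ h₁ h₂ h₃).symm.trans hyt)
      refine le_max_of_le_right (le_max_of_le_left (le_of_eq ?_))
      rw [charFn_mul_of_mem, e]
      simp only [giniRegion2, mem_ofPred_eq, max_eq_left hba, min_eq_right hba, e]
      exact ⟨hmem, max_le h₁ h₂, h₃⟩
    · have e := giniTheta3_eq hba h₀ hs h₂ ((minGini_branch₃ h₀ h₁ h₂).symm.trans hyt)
      refine le_max_of_le_right (le_max_of_le_right (le_max_of_le_left (le_of_eq ?_)))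
      rw [charFn_mul_of_mem, e]
      simp only [giniRegion3, mem_ofPred_eq, max_eq_left hba, min_eq_right hba, e]
      exact ⟨hmem, h₁, h₂⟩
    · have e := giniTheta4_eq hba h₀ hs h₂ ((minGini_branch₄ hs h₁ h₂).symm.trans hyt)
      refine le_max_of_le_right (le_max_of_le_right (le_max_of_le_right
        (le_max_of_le_left (le_of_eq ?_))))
      rw [charFn_mul_of_mem, e]
      simp only [giniRegion4, mem_ofPred_eq, max_eq_left hba, min_eq_right hba, e]
      exact ⟨hmem, h₁, h₂⟩
    · have e := giniTheta5_eq h₀ hs ((minGini_branch₅ h₀ h₁ h₂).symm.trans hyt)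
      refine le_max_of_le_right (le_max_of_le_right (le_max_of_le_right
        (le_max_of_le_right (le_of_eq ?_))))
      rw [charFn_mul_of_mem, e]
      simp only [giniRegion5, mem_ofPred_eq, max_eq_left hba, min_eq_right hba, e]
      exact ⟨hmem, le_min h₁ h₂⟩

theorem giniBranchMax_comm (t u v : ℝ) : giniBranchMax t u v = giniBranchMax t v u := by
  have e₁ : giniTheta1 t u v = giniTheta1 t v u := by unfold giniTheta1; ring_nf
  have e₂ : giniTheta2 t u v = giniTheta2 t v u := by
    unfold giniTheta2; rw [max_comm, min_comm]; ring_nf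
  have e₃ : giniTheta3 t u v = giniTheta3 t v u := by
    unfold giniTheta3; rw [max_comm, min_comm]; ring_nf
  have e₄ : giniTheta4 t u v = giniTheta4 t v u := by
    unfold giniTheta4; rw [max_comm, min_comm]; ring_nf
  have e₅ : giniTheta5 t u v = giniTheta5 t v u := by unfold giniTheta5; ring_nf
  have c : ∀ S : Set (ℝ × ℝ), ((u, v) ∈ S ↔ (v, u) ∈ S) → charFn S u v = charFn S v u :=
    fun S h => by by_cases hS : (u, v) ∈ S <;> simp [charFn, hS, ← h]
  have c₁ := c (giniRegion1 t) (by
    simp only [giniRegion1, mem_ofPred_eq, mem_prod, e₁, max_comm u v,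
      and_comm (a := u ∈ Icc (0 : ℝ) 1)])
  have c₂ := c (giniRegion2 t) (by
    simp only [giniRegion2, mem_ofPred_eq, mem_prod, e₂, max_comm u v, min_comm u v,
      and_comm (a := u ∈ Icc (0 : ℝ) 1)])
  have c₃ := c (giniRegion3 t) (by
    simp only [giniRegion3, mem_ofPred_eq, mem_prod, e₃, max_comm u v, min_comm u v,
      and_comm (a := u ∈ Icc (0 : ℝ) 1)])
  have c₄ := c (giniRegion4 t) (by
    simp only [giniRegion4, mem_ofPred_eq, mem_prod, e₄, max_comm u v, min_comm u v,
      and_comm (a := u ∈ Icc (0 : ℝ) 1)])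
  have c₅ := c (giniRegion5 t) (by
    simp only [giniRegion5, mem_ofPred_eq, mem_prod, e₅, max_comm u v, min_comm u v,
      and_comm (a := u ∈ Icc (0 : ℝ) 1)])
  simp only [giniBranchMax, e₁, e₂, e₃, e₄, e₅, c₁, c₂, c₃, c₄, c₅]

/-! ### Symmetries of the value sets and the extremal values -/

theorem giniValues_comm (t u v : ℝ) : giniValues t u v = giniValues t v u := by
  have h : ∀ u v : ℝ, giniValues t u v ⊆ giniValues t v u := by
    rintro u v _ ⟨C, ⟨hC, hCt⟩, rfl⟩
    exact ⟨_, ⟨hC.transpose, hC.giniGamma_transpose.trans hCt⟩, rfl⟩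
  exact (h u v).antisymm (h v u)

theorem mem_giniValues_reflect {t u v x : ℝ} (h : x ∈ giniValues t u v) :
    v - x ∈ giniValues (-t) (1 - u) v := by
  obtain ⟨C, ⟨hC, rfl⟩, rfl⟩ := h
  exact ⟨_, ⟨hC.reflect, hC.giniGamma_reflect⟩, by simp only [sub_sub_cancel]⟩

/-- The maximum of the values at `(u, v)` of the copulas with Gini's gamma `t`. -/
theorem isGreatest_giniValues {t u v : ℝ} (ht : t ∈ Icc (-1 : ℝ) 1) (hu : u ∈ Icc (0 : ℝ) 1)
    (hv : v ∈ Icc (0 : ℝ) 1) :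
    IsGreatest (giniValues t u v) (min u (min v (giniBranchMax t u v))) := by
  wlog hvu : v ≤ u generalizing u v
  · have := this hv hu (le_of_not_ge hvu)
    rwa [giniValues_comm, giniBranchMax_comm, min_left_comm] at this
  obtain ⟨y, hy, hyt⟩ := exists_minGini_eq hu.2 hvu hv.1 ht
  have hWv : max 0 (u + v - 1) ≤ v := max_le hv.1 (by linarith [hu.2])
  rw [giniBranchMax_eq ht.1 hu hv hvu hy hyt, min_eq_right ((min_le_left v y).trans hvu)]
  have copula : ∀ θ, max 0 (u + v - 1) ≤ θ → θ ≤ v → IsCopula (minCopulaAt θ u v) ∧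
      giniGamma (minCopulaAt θ u v) = minGini u v θ := fun θ hθ hθv => by
    obtain ⟨h₀, hs⟩ := max_le_iff.1 hθ
    exact ⟨isCopula_minCopulaAt hu.2 (hθv.trans hvu) hθv,
      giniGamma_minCopulaAt hu.2 h₀ hs hvu hθv⟩
  constructor
  · rcases le_total y v with h | h
    · obtain ⟨hC, hγ⟩ := copula y hy h
      rw [min_eq_right h]
      exact ⟨_, ⟨hC, hγ.trans hyt⟩, minCopulaAt_self hy⟩
    -- Here y is too large to be a copula value. The smallest copula with value v has γ ≤ t, and
    -- `min` has γ = 1 ≥ t; mixing them reaches t and keeps the value v.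
    · obtain ⟨hC, hγ⟩ := copula v hWv le_rfl
      have hle : minGini u v v ≤ t := hyt ▸ (minGini_strictMonoOn u v).monotoneOn hWv hy h
      rw [min_eq_left h]
      obtain ⟨p, q, hp, hq, hpq, hcomb⟩ :
          ∃ p q : ℝ, 0 ≤ p ∧ 0 ≤ q ∧ p + q = 1 ∧ p * minGini u v v + q * 1 = t := by
        have : t ∈ segment ℝ (minGini u v v) 1 := by
          rw [segment_eq_Icc (hle.trans ht.2)]
          exact ⟨hle, ht.2⟩
        simpa only [segment, mem_ofPred_eq, smul_eq_mul, exists_and_left] using this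
      obtain rfl : q = 1 - p := by linarith
      refine ⟨_, ⟨hC.convexCombination isCopula_min hp (by linarith), ?_⟩, ?_⟩
      · rw [hC.giniGamma_convexCombination isCopula_min hp (by linarith), hγ, giniGamma_min, hcomb]
      · simp only [minCopulaAt_self hWv, min_eq_right hvu]
        ring
  · rintro _ ⟨C, ⟨hC, rfl⟩, rfl⟩
    have hCv : C u v ≤ v := (hC.le_min hu hv).trans (min_le_right _ _)
    have hWC := hC.max_le hu hv
    obtain ⟨hC', hγ⟩ := copula _ hWC hCv
    refine le_min hCv ((minGini_strictMonoOn u v).le_iff_le hWC hy |>.1 ?_)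
    rw [hyt, ← hγ]
    exact hC'.giniGamma_mono hC fun x hx z hz => hC.minCopulaAt_le hu hv hx hz

theorem mainTheorem1 (t : ℝ) (ht : t ∈ Set.Icc (-1 : ℝ) 1)
    (u v : ℝ) (hu : u ∈ Set.Icc (0 : ℝ) 1) (hv : v ∈ Set.Icc (0 : ℝ) 1) :
    IsLUB (giniValues t u v) (giniUpper t u v) ∧
    IsGLB (giniValues t u v) (giniLower t u v) ∧
    giniUpper t u v =
      min u (min v
        (max (charFn (giniRegion1 t) u v * giniTheta1 t u v)
        (max (charFn (giniRegion2 t) u v * giniTheta2 t u v)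
        (max (charFn (giniRegion3 t) u v * giniTheta3 t u v)
        (max (charFn (giniRegion4 t) u v * giniTheta4 t u v)
          (charFn (giniRegion5 t) u v * giniTheta5 t u v)))))) ∧
    giniLower t u v = v - giniUpper (-t) (1 - u) v := by
  have hG := isGreatest_giniValues ht hu hv
  have hG' := isGreatest_giniValues (t := -t) (u := 1 - u)
    ⟨by linarith [ht.2], by linarith [ht.1]⟩ ⟨by linarith [hu.2], by linarith [hu.1]⟩ hv
  rw [← hG'.csSup_eq] at hG'
  -- Reflection is an involution carrying the values for (-t, 1 - u) to those for (t, u) by x ↦ v -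
  -- x, so the greatest becomes the least.
  have hL : IsLeast (giniValues t u v) (v - giniUpper (-t) (1 - u) v) := by
    refine ⟨by simpa only [giniUpper, sub_sub_cancel, neg_neg] using mem_giniValues_reflect hG'.1,
      fun x hx => ?_⟩
    have := hG'.2 (mem_giniValues_reflect hx)
    rw [giniUpper]
    linarith
  refine ⟨?_, ?_, hG.csSup_eq, hL.csInf_eq⟩
  · rw [giniUpper, hG.csSup_eq]; exact hG.isLUB
  · rw [giniLower, hL.csInf_eq]; exact hL.isGLB
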